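/- Let $d\in\mathbb N$ and let $\Omega\subset\mathbb R^d$ be a bounded open set, for instance a bounded domain with Lipschitz boundary. $\langle\cdot,\cdot\rangle$ denotes the inner product of $L^2(\Omega)$ or $L^2(\Omega)^d$; $H(\mathrm{div};\Omega)$ is the space of $v\in L^2(\Omega)^d$ with weak divergence $\nabla\cdot v\in L^2(\Omega)$; $H^1_0(\Omega)$ is the closure of $C_c^\infty(\Omega)$ in $H^1(\Omega)$ (for a Lipschitz domain: the $H^1$ functions with vanishing trace). Let $s:\mathbb R\to[0,1]$ be monotone increasing and Lipschitz continuous. Let $a:\mathbb R\to\mathbb R$ be Lipschitz continuous with $0<a_\star\le a(y)\le a^\star<\infty$ for all $y\in\mathbb R$. Let $f_w,f_2:\mathbb R\to\mathbb R$ and $\mathbf f_1,\mathbf f_3:\mathbb R\to\mathbb R^d$ be Lipschitz continuous, with $f_w$ bounded. Let $\tau>0$ be the time step and let $\Theta^{n-1}\in L^2(\Omega)$ be given. Problem $P^n$ (mixed): find $\Theta^n,p^n\in L^2(\Omega)$ and $\mathbf q^n,\mathbf u^n\in H(\mathrm{div};\Omega)$ such that, with $s^k=s(\Theta^k)$, $$\langle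 s^n-s^{n-1},w\rangle+\tau\langle\nabla\cdot\mathbf q^n,w\rangle=0,$$ $$\langle\mathbf q^n,\mathbf v\rangle-\langle\Theta^n,\nabla\cdot\mathbf v\rangle-\langle f_w(s^n)\mathbf u^n,\mathbf v\rangle=\langle\mathbf f_1(s^n),\mathbf v\rangle,$$ $$\langle\nabla\cdot\mathbf u^n,w\rangle=\langle f_2(s^n),w\rangle,$$ $$\langle a(s^n)\mathbf u^n,\mathbf v\rangle-\langle p^n,\nabla\cdot\mathbf v\rangle+\langle\mathbf f_3(s^n),\mathbf v\rangle=0$$ for all $w\in L^2(\Omega)$ and all $\mathbf v\in H(\mathrm{div};\Omega)$. Problem $PC^n$ (conformal): find $\Theta_C^n,p_C^n\in H^1_0(\Omega)$ such that, with $s_C^n=s(\Theta_C^n)$, $$\langle s_C^n-s(\Theta^{n-1}),v\rangle+\tau\Big\langle\nabla\Theta_C^n+\frac{f_w(s_C^n)}{a(s_C^n)}\nabla p_C^n,\nabla v\Big\rangle+\tau\Big\langle\frac{f_w(s_C^n)}{a(s_C^n)}\mathbf f_3(s_C^n)-\mathbf f_1(s_C^n),\nabla v\Big\rangle=0,$$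 $$\Big\langle\frac1{a(s_C^n)}\big(\nabla p_C^n+\mathbf f_3(s_C^n)\big),\nabla w\Big\rangle=\langle f_2(s_C^n),w\rangle$$ for all $v,w\in H^1_0(\Omega)$. Then: (i) If $(\Theta_C^n,p_C^n)$ solves $PC^n$, then a solution of $P^n$ is given by $\Theta^n=\Theta_C^n$, $p^n=p_C^n$, $$\mathbf q^n=-\nabla\Theta_C^n-\frac{f_w(s_C^n)}{a(s_C^n)}\big(\nabla p_C^n+\mathbf f_3(s_C^n)\big)+\mathbf f_1(s_C^n),\qquad \mathbf u^n=-\frac1{a(s_C^n)}\big(\nabla p_C^n+\mathbf f_3(s_C^n)\big).$$ (ii) Conversely, if $(\Theta^n,p^n,\mathbf q^n,\mathbf u^n)$ solves $P^n$, then $\Theta^n,p^n\in H^1_0(\Omega)$ and $(\Theta^n,p^n)$ solves $PC^n$. (iii) Consequently, existence and uniqueness carry over: $P^n$ has a solution if and only if $PC^n$ has one, and $P^n$ has at most one solution if and only if $PC^n$ has at most one. -/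

import Mathlib

open MeasureTheory Set
open scoped ContDiff ENNReal

noncomputable section

namespace TwoPhase

/-- The Euclidean space `ℝ^d`. -/
abbrev E (d : ℕ) := EuclideanSpace ℝ (Fin d)

/-- Scalar `L²(Ω)`. -/
abbrev L2 {d : ℕ} (Ω : Set (E d)) := Lp ℝ 2 ((volume : Measure (E d)).restrict Ω)

/-- Vector-valued `L²(Ω)^d`. -/
abbrev L2V {d : ℕ} (Ω : Set (E d)) := Lp (E d) 2 ((volume : Measure (E d)).restrict Ω)

/-- `φ ∈ C_c^∞(Ω)`. -/
structure IsTest {d : ℕ} (Ω : Set (E d)) (φ : E d → ℝ) : Prop where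
  smooth : ContDiff ℝ ∞ φ
  compact : HasCompactSupport φ
  supp : tsupport φ ⊆ Ω

/-- `g` is the weak gradient of `u` on `Ω`. -/
def HasWeakGrad {d : ℕ} {Ω : Set (E d)} (u : L2 Ω) (g : L2V Ω) : Prop :=
  ∀ φ : E d → ℝ, IsTest Ω φ → ∀ i : Fin d,
    ∫ x in Ω, u x * fderiv ℝ φ x (EuclideanSpace.single i 1) = -∫ x in Ω, g x i * φ x

/-- `h` is the weak divergence of `v` on `Ω`. -/
def HasWeakDiv {d : ℕ} {Ω : Set (E d)} (v : L2V Ω) (h : L2 Ω) : Prop :=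
  ∀ φ : E d → ℝ, IsTest Ω φ →
    ∫ x in Ω, inner ℝ (v x) (gradient φ x) = -∫ x in Ω, h x * φ x

/-- `u ∈ H¹(Ω)`. -/
def MemH1 {d : ℕ} {Ω : Set (E d)} (u : L2 Ω) : Prop := ∃ g : L2V Ω, HasWeakGrad u g

/-- `v ∈ H(div; Ω)`. -/
def MemHdiv {d : ℕ} {Ω : Set (E d)} (v : L2V Ω) : Prop := ∃ h : L2 Ω, HasWeakDiv v h

open Classical in
/-- The weak gradient `∇u` of `u ∈ H¹(Ω)` (and `0` for other `u`). -/
def weakGrad {d : ℕ} {Ω : Set (E d)} (u : L2 Ω) : L2V Ω :=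
  if h : MemH1 u then h.choose else 0

open Classical in
/-- The weak divergence `∇ · v` of `v ∈ H(div; Ω)` (and `0` for other `v`). -/
def weakDiv {d : ℕ} {Ω : Set (E d)} (v : L2V Ω) : L2 Ω :=
  if h : MemHdiv v then h.choose else 0

/-- `u ∈ H¹₀(Ω)`, the closure of `C_c^∞(Ω)` in `H¹(Ω)`. -/
def MemH10 {d : ℕ} {Ω : Set (E d)} (u : L2 Ω) : Prop :=
  MemH1 u ∧ ∀ ε : ℝ≥0∞, 0 < ε → ∃ φ : E d → ℝ, IsTest Ω φ ∧
    eLpNorm (fun x => φ x - u x) 2 (volume.restrict Ω) < ε ∧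
    eLpNorm (fun x => gradient φ x - weakGrad u x) 2 (volume.restrict Ω) < ε

/-- Square integrable functions on `Ω` that agree on all test functions are equal a.e. -/
theorem ae_eq_of_test {d : ℕ} {Ω : Set (E d)} (hΩ : IsOpen Ω) {f g : E d → ℝ}
    (hf : MemLp f 2 ((volume : Measure (E d)).restrict Ω))
    (hg : MemLp g 2 ((volume : Measure (E d)).restrict Ω))
    (h : ∀ φ : E d → ℝ, IsTest Ω φ → ∫ x in Ω, f x * φ x = ∫ x in Ω, g x * φ x) :
    f =ᵐ[(volume : Measure (E d)).restrict Ω] g := by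
  have hfg : LocallyIntegrableOn (fun x => f x - g x) Ω volume := by
    rw [locallyIntegrableOn_iff hΩ.isLocallyClosed]
    intro K hK hKc
    have h1 : MemLp (fun x => f x - g x) 2 ((volume : Measure (E d)).restrict K) :=
      (hf.sub hg).mono_measure (Measure.restrict_mono hK le_rfl)
    have : IsFiniteMeasure ((volume : Measure (E d)).restrict K) :=
      ⟨by simpa using hKc.measure_lt_top⟩
    exact h1.integrable (by norm_num)
  have key := hΩ.ae_eq_zero_of_integral_contDiff_smul_eq_zero hfg (fun φ h1 h2 h3 => by
    have hφ : MemLp φ 2 ((volume : Measure (E d)).restrict Ω) :=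
      (h1.continuous.memLp_of_hasCompactSupport h2).mono_measure Measure.restrict_le_self
    have e1 : ∫ x, φ x • (f x - g x) = ∫ x in Ω, φ x • (f x - g x) := by
      refine (setIntegral_eq_integral_of_forall_compl_eq_zero fun x hx => ?_).symm
      rw [image_eq_zero_of_notMem_tsupport (fun hx' => hx (h3 hx')), zero_smul]
    rw [e1, ← sub_eq_zero.mpr (h φ ⟨h1, h2, h3⟩)]
    refine Eq.trans ?_ (integral_sub (hf.integrable_mul hφ) (hg.integrable_mul hφ))
    refine integral_congr_ae (Filter.Eventually.of_forall fun x => ?_)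
    simp only [smul_eq_mul, Pi.mul_apply]
    ring)
  refine (ae_restrict_iff' hΩ.measurableSet).mpr ?_
  filter_upwards [key] with x hx hxΩ
  exact sub_eq_zero.mp (hx hxΩ)

/-- Weak divergences are unique, so `weakDiv` does not depend on the choice made in it. -/
theorem HasWeakDiv.weakDiv_eq {d : ℕ} {Ω : Set (E d)} (hΩ : IsOpen Ω) {v : L2V Ω} {h : L2 Ω}
    (hv : HasWeakDiv v h) : weakDiv v = h := by
  have hex : MemHdiv v := ⟨h, hv⟩
  rw [weakDiv, dif_pos hex]
  refine Lp.ext (ae_eq_of_test hΩ (Lp.memLp _) (Lp.memLp _) fun φ hφ => ?_)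
  exact neg_injective ((hex.choose_spec φ hφ).symm.trans (hv φ hφ))

/-- Weak gradients are unique, so `weakGrad` does not depend on the choice made in it. -/
theorem HasWeakGrad.weakGrad_eq {d : ℕ} {Ω : Set (E d)} (hΩ : IsOpen Ω) {u : L2 Ω} {g : L2V Ω}
    (hu : HasWeakGrad u g) : weakGrad u = g := by
  have hex : MemH1 u := ⟨g, hu⟩
  rw [weakGrad, dif_pos hex]
  have hc : ∀ (k : L2V Ω) (i : Fin d),
      MemLp (fun x => k x i) 2 ((volume : Measure (E d)).restrict Ω) := fun k i =>
    (EuclideanSpace.proj (𝕜 := ℝ) i).comp_memLp' (Lp.memLp k)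
  have hi : ∀ i : Fin d, ∀ᵐ x ∂((volume : Measure (E d)).restrict Ω),
      hex.choose x i = g x i := fun i =>
    ae_eq_of_test hΩ (hc _ i) (hc _ i) fun φ hφ =>
      neg_injective ((hex.choose_spec φ hφ i).symm.trans (hu φ hφ i))
  refine Lp.ext ?_
  filter_upwards [ae_all_iff.mpr hi] with x hx
  ext i
  exact hx i

/-- The coefficient functions of the model. -/
structure Coeffs (d : ℕ) where
  s : ℝ → ℝ
  a : ℝ → ℝ
  fw : ℝ → ℝ
  f₁ : ℝ → E d
  f₂ : ℝ → ℝ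
  f₃ : ℝ → E d

/-- The assumptions on the coefficient functions. -/
structure Coeffs.Admissible {d : ℕ} (c : Coeffs d) : Prop where
  s_mem : ∀ y, c.s y ∈ Icc (0 : ℝ) 1
  s_mono : Monotone c.s
  s_lip : ∃ K, LipschitzWith K c.s
  a_lip : ∃ K, LipschitzWith K c.a
  a_bounds : ∃ m M : ℝ, 0 < m ∧ ∀ y, m ≤ c.a y ∧ c.a y ≤ M
  f₁_lip : ∃ K, LipschitzWith K c.f₁
  f₂_lip : ∃ K, LipschitzWith K c.f₂
  f₃_lip : ∃ K, LipschitzWith K c.f₃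
  fw_lip : ∃ K, LipschitzWith K c.fw
  fw_bdd : ∃ M : ℝ, ∀ y, |c.fw y| ≤ M

/-- `(Θ, p, q, u)` solves the semi-discrete mixed problem `Pⁿ` with time step `τ` and
previous iterate `Θ' = Θⁿ⁻¹`. -/
structure SolvesMixed {d : ℕ} {Ω : Set (E d)} (c : Coeffs d) (τ : ℝ) (Θ' : L2 Ω)
    (Θ p : L2 Ω) (q u : L2V Ω) : Prop where
  q_mem : MemHdiv q
  u_mem : MemHdiv u
  balance : ∀ w : L2 Ω,
    (∫ x in Ω, (c.s (Θ x) - c.s (Θ' x)) * w x) + τ * ∫ x in Ω, weakDiv q x * w x = 0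
  flux : ∀ v : L2V Ω, MemHdiv v →
    (∫ x in Ω, inner ℝ (q x) (v x)) - (∫ x in Ω, Θ x * weakDiv v x)
      - (∫ x in Ω, inner ℝ (c.fw (c.s (Θ x)) • u x) (v x))
      = ∫ x in Ω, inner ℝ (c.f₁ (c.s (Θ x))) (v x)
  total_balance : ∀ w : L2 Ω,
    ∫ x in Ω, weakDiv u x * w x = ∫ x in Ω, c.f₂ (c.s (Θ x)) * w x
  total_flux : ∀ v : L2V Ω, MemHdiv v →
    (∫ x in Ω, inner ℝ (c.a (c.s (Θ x)) • u x) (v x)) - (∫ x in Ω, p x * weakDiv v x)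
      + (∫ x in Ω, inner ℝ (c.f₃ (c.s (Θ x))) (v x)) = 0

/-- `(Θ, p)` solves the semi-discrete conformal problem `PCⁿ` with time step `τ` and
previous iterate `Θ' = Θⁿ⁻¹`. -/
structure SolvesConformal {d : ℕ} {Ω : Set (E d)} (c : Coeffs d) (τ : ℝ) (Θ' : L2 Ω)
    (Θ p : L2 Ω) : Prop where
  Θ_mem : MemH10 Θ
  p_mem : MemH10 p
  saturation : ∀ v : L2 Ω, MemH10 v →
    (∫ x in Ω, (c.s (Θ x) - c.s (Θ' x)) * v x)
      + τ * ((∫ x in Ω, inner ℝ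
            (weakGrad Θ x + (c.fw (c.s (Θ x)) / c.a (c.s (Θ x))) • weakGrad p x) (weakGrad v x))
          + ∫ x in Ω, inner ℝ
            ((c.fw (c.s (Θ x)) / c.a (c.s (Θ x))) • c.f₃ (c.s (Θ x)) - c.f₁ (c.s (Θ x)))
            (weakGrad v x)) = 0
  pressure : ∀ w : L2 Ω, MemH10 w →
    ∫ x in Ω, inner ℝ ((1 / c.a (c.s (Θ x))) • (weakGrad p x + c.f₃ (c.s (Θ x)))) (weakGrad w x)
      = ∫ x in Ω, c.f₂ (c.s (Θ x)) * w x

end TwoPhase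

end

open TwoPhase

noncomputable section

namespace TwoPhase

variable {d : ℕ} {Ω : Set (E d)}

/-! ### Test functions as elements of `L²` -/

/-! The two problems are linked by Green's identity `⟨u, ∇·v⟩ + ⟨∇u, v⟩ = 0`, read as a duality
between `H¹₀(Ω)` and `H(div; Ω)`. In the Hilbert space `L² × (L²)^d`, let `G` be the set of pairs
`(φ, ∇φ)` with `φ` a test function. By definition of the weak divergence, `Gᗮ` consists of the pairs
`(∇·v, v)`; the closure of `G` is the graph of `∇` on `H¹₀`. Since `Gᗮᗮ` is the closure of `G`, a
pair `(u, g)` satisfies Green's identity against all of `H(div)` exactly when `u ∈ H¹₀` and `∇u = g`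
(`memH10_iff_green`). No trace or boundary regularity enters.

Each mixed flux equation is such an identity, for `Θ` or for `p`, so it says that the unknown lies
in `H¹₀` and prescribes its gradient; solving for `q` and `u`, with `a ≠ 0`, gives the flux formulas
(`flux_equations_iff`). Dually, `hasWeakDiv_iff_green` turns the conservation equations, which
prescribe `∇·q` and `∇·u`, into the conformal equations (`balance_equations_iff`). A mixed solution
is thus a conformal solution with its uniquely determined fluxes (`solvesMixed_iff`). -/

theorem IsTest.continuous_gradient {φ : E d → ℝ} (hφ : IsTest Ω φ) : Continuous (gradient φ) :=
  (InnerProductSpace.toDual ℝ (E d)).symm.continuous.comp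
    (hφ.smooth.continuous_fderiv (by simp))

theorem IsTest.hasCompactSupport_gradient {φ : E d → ℝ} (hφ : IsTest Ω φ) :
    HasCompactSupport (gradient φ) :=
  (hφ.compact.fderiv (𝕜 := ℝ)).comp_left (map_zero (InnerProductSpace.toDual ℝ (E d)).symm)

theorem IsTest.memLp {φ : E d → ℝ} (hφ : IsTest Ω φ) :
    MemLp φ 2 ((volume : Measure (E d)).restrict Ω) :=
  (hφ.smooth.continuous.memLp_of_hasCompactSupport hφ.compact).mono_measure
    Measure.restrict_le_self

theorem IsTest.memLp_gradient {φ : E d → ℝ} (hφ : IsTest Ω φ) :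
    MemLp (gradient φ) 2 ((volume : Measure (E d)).restrict Ω) :=
  (hφ.continuous_gradient.memLp_of_hasCompactSupport hφ.hasCompactSupport_gradient).mono_measure
    Measure.restrict_le_self

theorem gradient_apply_eq_fderiv {φ : E d → ℝ} (x : E d) (i : Fin d) :
    gradient φ x i = fderiv ℝ φ x (EuclideanSpace.single i 1) := by
  have h : inner ℝ (gradient φ x) (EuclideanSpace.single i (1 : ℝ))
      = fderiv ℝ φ x (EuclideanSpace.single i 1) := by
    simp [gradient]
  rw [← h, EuclideanSpace.inner_single_right]
  simp

theorem IsTest.zero : IsTest Ω (fun _ : E d => (0 : ℝ)) where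
  smooth := contDiff_const
  compact := HasCompactSupport.zero
  supp := by simp [tsupport]

theorem gradient_zero_fun : gradient (fun _ : E d => (0 : ℝ)) = fun _ => 0 := by
  funext x; simp [gradient]

theorem IsTest.add {φ ψ : E d → ℝ} (hφ : IsTest Ω φ) (hψ : IsTest Ω ψ) :
    IsTest Ω (fun x => φ x + ψ x) where
  smooth := hφ.smooth.add hψ.smooth
  compact := hφ.compact.add hψ.compact
  supp := (tsupport_add φ ψ).trans (union_subset hφ.supp hψ.supp)

theorem IsTest.gradient_add {φ ψ : E d → ℝ} (hφ : IsTest Ω φ) (hψ : IsTest Ω ψ) :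
    gradient (fun x => φ x + ψ x) = fun x => gradient φ x + gradient ψ x := by
  funext x
  simp only [gradient]
  rw [fderiv_fun_add (hφ.smooth.differentiable (by simp) x)
    (hψ.smooth.differentiable (by simp) x), map_add]

theorem IsTest.const_mul {φ : E d → ℝ} (hφ : IsTest Ω φ) (r : ℝ) :
    IsTest Ω (fun x => r * φ x) where
  smooth := contDiff_const.mul hφ.smooth
  compact := hφ.compact.mul_left (f := fun _ => r)
  supp := (tsupport_mul_subset_right (f := fun _ => r) (g := φ)).trans hφ.supp

theorem IsTest.gradient_const_mul {φ : E d → ℝ} (hφ : IsTest Ω φ) (r : ℝ) :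
    gradient (fun x => r * φ x) = fun x => r • gradient φ x := by
  funext x
  simp only [gradient]
  rw [fderiv_const_mul (hφ.smooth.differentiable (by simp) x)]
  simp

/-! ### `L²` inner products as integrals -/

theorem integral_inner_eq' {A v : L2V Ω} {f g : E d → E d}
    (hf : ∀ᵐ x ∂(volume.restrict Ω), A x = f x) (hg : ∀ᵐ x ∂(volume.restrict Ω), v x = g x) :
    ∫ x in Ω, inner ℝ (f x) (g x) = inner ℝ A v := by
  rw [L2.inner_def]
  refine integral_congr_ae ?_
  filter_upwards [hf, hg] with x hx hx'
  rw [hx, hx']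

theorem integral_inner_eq {A v : L2V Ω} {f : E d → E d}
    (hf : ∀ᵐ x ∂(volume.restrict Ω), A x = f x) :
    ∫ x in Ω, inner ℝ (f x) (v x) = inner ℝ A v :=
  integral_inner_eq' hf (Filter.Eventually.of_forall fun _ => rfl)

theorem integral_mul_eq {A v : L2 Ω} {f g : E d → ℝ}
    (hf : ∀ᵐ x ∂(volume.restrict Ω), A x = f x) (hg : ∀ᵐ x ∂(volume.restrict Ω), v x = g x) :
    ∫ x in Ω, f x * g x = inner ℝ A v := by
  rw [L2.inner_def]
  refine integral_congr_ae ?_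
  filter_upwards [hf, hg] with x hx hx'
  rw [hx, hx']
  simp [mul_comm]

theorem ae_refl {F : Type*} {f : E d → F} : ∀ᵐ x ∂(volume.restrict Ω), f x = f x :=
  Filter.Eventually.of_forall fun _ => rfl

/-- The integration-by-parts identity behind `HasWeakDiv`, in terms of `L²` inner products. -/
theorem hasWeakDiv_iff {v : L2V Ω} {h : L2 Ω} :
    HasWeakDiv v h ↔ ∀ (φ : E d → ℝ) (hφ : IsTest Ω φ),
      inner ℝ hφ.memLp.toLp h + inner ℝ hφ.memLp_gradient.toLp v = 0 := by
  refine forall₂_congr fun φ hφ => ?_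
  rw [integral_inner_eq' (A := v) (v := hφ.memLp_gradient.toLp) ae_refl
      hφ.memLp_gradient.coeFn_toLp,
    integral_mul_eq (A := h) (v := hφ.memLp.toLp) ae_refl hφ.memLp.coeFn_toLp,
    real_inner_comm, real_inner_comm h]
  constructor <;> intro H <;> linarith

/-! ### The graph of the gradient on test functions -/

variable (Ω) in
/-- The pairs `(φ, ∇φ)` with `φ ∈ C_c^∞(Ω)`, as a subspace of `L²(Ω) × L²(Ω)^d`. -/
def testGraph : Submodule ℝ (WithLp 2 (L2 Ω × L2V Ω)) where
  carrier := {z | ∃ (φ : E d → ℝ) (hφ : IsTest Ω φ),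
    z = WithLp.toLp 2 (hφ.memLp.toLp, hφ.memLp_gradient.toLp)}
  zero_mem' := by
    refine ⟨_, IsTest.zero, ?_⟩
    have h1 : (IsTest.zero (Ω := Ω)).memLp.toLp = 0 := MemLp.toLp_zero _
    have h2 : (IsTest.zero (Ω := Ω)).memLp_gradient.toLp = 0 := by
      rw [Lp.eq_zero_iff_ae_eq_zero]
      refine (MemLp.coeFn_toLp _).trans ?_
      rw [gradient_zero_fun]; rfl
    rw [h1, h2]; rfl
  add_mem' := by
    rintro _ _ ⟨φ, hφ, rfl⟩ ⟨ψ, hψ, rfl⟩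
    refine ⟨_, hφ.add hψ, ?_⟩
    have h1 : (hφ.add hψ).memLp.toLp = hφ.memLp.toLp + hψ.memLp.toLp :=
      MemLp.toLp_add hφ.memLp hψ.memLp
    have h2 : (hφ.add hψ).memLp_gradient.toLp
        = hφ.memLp_gradient.toLp + hψ.memLp_gradient.toLp := by
      rw [← MemLp.toLp_add hφ.memLp_gradient hψ.memLp_gradient]
      exact MemLp.toLp_congr _ _ (Filter.Eventually.of_forall (congrFun (hφ.gradient_add hψ)))
    rw [h1, h2]; rfl
  smul_mem' := by
    rintro r _ ⟨φ, hφ, rfl⟩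
    refine ⟨_, hφ.const_mul r, ?_⟩
    have h1 : (hφ.const_mul r).memLp.toLp = r • hφ.memLp.toLp :=
      MemLp.toLp_const_smul r hφ.memLp
    have h2 : (hφ.const_mul r).memLp_gradient.toLp = r • hφ.memLp_gradient.toLp := by
      rw [← MemLp.toLp_const_smul r hφ.memLp_gradient]
      exact MemLp.toLp_congr _ _ (Filter.Eventually.of_forall (congrFun (hφ.gradient_const_mul r)))
    rw [h1, h2]; rfl

/-- The orthogonal complement of the gradient graph is the (flipped) graph of the divergence. -/
theorem mem_testGraph_orthogonal {h : L2 Ω} {v : L2V Ω} :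
    WithLp.toLp 2 (h, v) ∈ (testGraph Ω)ᗮ ↔ HasWeakDiv v h := by
  rw [hasWeakDiv_iff, Submodule.mem_orthogonal]
  constructor
  · intro H φ hφ
    simpa [WithLp.prod_inner_apply] using H _ ⟨φ, hφ, rfl⟩
  · rintro H _ ⟨φ, hφ, rfl⟩
    simpa [WithLp.prod_inner_apply] using H φ hφ

/-- In a Hilbert space the closure of a subspace is its double orthogonal complement. The 2-norm on
the product in `testGraph` is what makes this available. -/
theorem mem_testGraph_closure {u : L2 Ω} {g : L2V Ω} :
    WithLp.toLp 2 (u, g) ∈ (testGraph Ω).topologicalClosure ↔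
      ∀ (v : L2V Ω) (h : L2 Ω), HasWeakDiv v h → inner ℝ u h + inner ℝ g v = 0 := by
  rw [← Submodule.orthogonal_orthogonal_eq_closure, Submodule.mem_orthogonal']
  constructor
  · intro H v h hv
    simpa [WithLp.prod_inner_apply] using H _ (mem_testGraph_orthogonal.2 hv)
  · intro H z hz
    have := H z.snd z.fst (mem_testGraph_orthogonal.1 hz)
    simpa [WithLp.prod_inner_apply] using this

/-- Integration by parts for two test functions. -/
theorem IsTest.integral_mul_gradient {φ ψ : E d → ℝ} (hφ : IsTest Ω φ) (hψ : IsTest Ω ψ)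
    (i : Fin d) :
    ∫ x in Ω, φ x * gradient ψ x i = -∫ x in Ω, gradient φ x i * ψ x := by
  have hc : ∀ {χ : E d → ℝ}, IsTest Ω χ →
      Continuous fun x => fderiv ℝ χ x (EuclideanSpace.single i 1) := fun hχ =>
    (hχ.smooth.continuous_fderiv (by simp)).clm_apply continuous_const
  -- Both integrands vanish off `Ω`, so the integration by parts takes place on the whole space,
  -- without boundary terms.
  rw [setIntegral_eq_integral_of_forall_compl_eq_zero fun x hx => by
      rw [image_eq_zero_of_notMem_tsupport (fun hx' => hx (hφ.supp hx')), zero_mul],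
    setIntegral_eq_integral_of_forall_compl_eq_zero fun x hx => by
      rw [image_eq_zero_of_notMem_tsupport (fun hx' => hx (hψ.supp hx')), mul_zero]]
  simp only [gradient_apply_eq_fderiv]
  refine integral_mul_fderiv_eq_neg_fderiv_mul_of_integrable ?_ ?_ ?_
    (fun x _ => hφ.smooth.differentiable (by simp) x)
    (fun x _ => hψ.smooth.differentiable (by simp) x)
  · exact ((hc hφ).mul hψ.smooth.continuous).integrable_of_hasCompactSupport hψ.compact.mul_left
  · exact (hφ.smooth.continuous.mul (hc hψ)).integrable_of_hasCompactSupport hφ.compact.mul_right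
  · exact (hφ.smooth.continuous.mul hψ.smooth.continuous).integrable_of_hasCompactSupport
      hφ.compact.mul_right

/-- Testing against the fields `φ eᵢ` shows that the closure consists of weak gradients. -/
theorem hasWeakGrad_of_green {u : L2 Ω} {g : L2V Ω}
    (H : ∀ (v : L2V Ω) (h : L2 Ω), HasWeakDiv v h → inner ℝ u h + inner ℝ g v = 0) :
    HasWeakGrad u g := by
  intro φ hφ i
  have hv : MemLp (fun x => φ x • EuclideanSpace.single i (1 : ℝ)) 2
      ((volume : Measure (E d)).restrict Ω) :=
    (ContinuousLinearMap.toSpanSingleton ℝ (EuclideanSpace.single i (1 : ℝ) : E d)).comp_memLp'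
      hφ.memLp
  have hh : MemLp (fun x => gradient φ x i) 2 ((volume : Measure (E d)).restrict Ω) :=
    (EuclideanSpace.proj (𝕜 := ℝ) i).comp_memLp' hφ.memLp_gradient
  -- The field `φ eᵢ` has divergence `∂ᵢφ`.
  have hdiv : HasWeakDiv (Ω := Ω) hv.toLp hh.toLp := by
    intro ψ hψ
    have h1 : ∫ x in Ω, inner ℝ ((hv.toLp : L2V Ω) x) (gradient ψ x)
        = ∫ x in Ω, φ x * gradient ψ x i := by
      refine integral_congr_ae ?_
      filter_upwards [hv.coeFn_toLp] with x hx
      rw [hx, real_inner_smul_left, EuclideanSpace.inner_single_left]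
      simp
    have h2 : ∫ x in Ω, (hh.toLp : L2 Ω) x * ψ x = ∫ x in Ω, gradient φ x i * ψ x := by
      refine integral_congr_ae ?_
      filter_upwards [hh.coeFn_toLp] with x hx
      rw [hx]
    rw [h1, h2, hφ.integral_mul_gradient hψ]
  have key := H _ _ hdiv
  rw [← integral_mul_eq (A := u) ae_refl hh.coeFn_toLp,
    ← integral_inner_eq' (A := g) ae_refl hv.coeFn_toLp] at key
  have h3 : ∫ x in Ω, inner ℝ (g x) (φ x • EuclideanSpace.single i (1 : ℝ))
      = ∫ x in Ω, g x i * φ x := by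
    refine integral_congr_ae (Filter.Eventually.of_forall fun x => ?_)
    simp only [real_inner_smul_right, EuclideanSpace.inner_single_right]
    simp [mul_comm]
  simp only [gradient_apply_eq_fderiv] at key
  linarith

/-! ### Green's formula as a duality between `H¹₀(Ω)` and `H(div; Ω)` -/

theorem eLpNorm_sub_eq_edist {F : Type*} [NormedAddCommGroup F] {f : E d → F}
    (hf : MemLp f 2 ((volume : Measure (E d)).restrict Ω))
    (u : Lp F 2 ((volume : Measure (E d)).restrict Ω)) :
    eLpNorm (fun x => f x - u x) 2 (volume.restrict Ω) = edist u hf.toLp := by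
  rw [edist_comm, Lp.edist_def]
  refine eLpNorm_congr_ae ?_
  filter_upwards [hf.coeFn_toLp] with x hx
  simp [hx]

/-- Green's formula characterizes `H¹₀(Ω)` and its weak gradients. -/
theorem memH10_iff_green (hΩ : IsOpen Ω) {u : L2 Ω} {g : L2V Ω} :
    MemH10 u ∧ weakGrad u = g ↔
      ∀ (v : L2V Ω) (h : L2 Ω), HasWeakDiv v h → inner ℝ u h + inner ℝ g v = 0 := by
  constructor
  · rintro ⟨⟨-, hu⟩, rfl⟩ v h hv
    -- For fixed `v` the identity is a closed condition on `(u, ∇u)` and holds for test functions,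
    -- hence it survives the `H¹` limit.
    have hclosed : IsClosed {z : L2 Ω × L2V Ω | inner ℝ z.1 h + inner ℝ z.2 v = 0} :=
      isClosed_eq (by fun_prop) continuous_const
    refine hclosed.closure_subset
      (EMetric.mem_closure_iff.2 fun ε hε => ?_ : (u, weakGrad u) ∈ _)
    obtain ⟨φ, hφ, h1, h2⟩ := hu ε hε
    refine ⟨(hφ.memLp.toLp, hφ.memLp_gradient.toLp), hasWeakDiv_iff.1 hv φ hφ, ?_⟩
    rw [eLpNorm_sub_eq_edist hφ.memLp] at h1
    rw [eLpNorm_sub_eq_edist hφ.memLp_gradient] at h2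
    rw [Prod.edist_eq]
    exact max_lt h1 h2
  · intro H
    have hg := hasWeakGrad_of_green H
    have hgrad := hg.weakGrad_eq hΩ
    refine ⟨⟨⟨g, hg⟩, fun ε hε => ?_⟩, hgrad⟩
    -- The closure is taken in the 2-norm; moving it to the sup metric of the plain product yields
    -- the two separate estimates required by `MemH10`.
    have hmem : (u, g) ∈ closure (WithLp.ofLp '' (testGraph Ω : Set (WithLp 2 (L2 Ω × L2V Ω)))) :=
      image_closure_subset_closure_image (WithLp.prod_continuous_ofLp 2 (L2 Ω) (L2V Ω))
        ⟨_, mem_testGraph_closure.2 H, rfl⟩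
    obtain ⟨_, ⟨_, ⟨φ, hφ, rfl⟩, rfl⟩, hlt⟩ := EMetric.mem_closure_iff.1 hmem ε hε
    obtain ⟨h1, h2⟩ := max_lt_iff.1 (Prod.edist_eq (u, g) _ ▸ hlt)
    refine ⟨φ, hφ, ?_, ?_⟩
    · rw [eLpNorm_sub_eq_edist hφ.memLp]; exact h1
    · rw [eLpNorm_sub_eq_edist hφ.memLp_gradient, hgrad]; exact h2

theorem IsTest.memH10 (hΩ : IsOpen Ω) {φ : E d → ℝ} (hφ : IsTest Ω φ) :
    MemH10 (Ω := Ω) hφ.memLp.toLp ∧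
      weakGrad (Ω := Ω) hφ.memLp.toLp = hφ.memLp_gradient.toLp :=
  (memH10_iff_green hΩ).2 fun _ _ hv => hasWeakDiv_iff.1 hv φ hφ

/-- Green's formula against `H¹₀(Ω)` characterizes weak divergences. -/
theorem hasWeakDiv_iff_green (hΩ : IsOpen Ω) {v : L2V Ω} {h : L2 Ω} :
    HasWeakDiv v h ↔ ∀ u : L2 Ω, MemH10 u → inner ℝ u h + inner ℝ (weakGrad u) v = 0 := by
  refine ⟨fun hv u hu => (memH10_iff_green hΩ).1 ⟨hu, rfl⟩ v h hv, fun H => ?_⟩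
  refine hasWeakDiv_iff.2 fun φ hφ => ?_
  have := H _ (hφ.memH10 hΩ).1
  rwa [(hφ.memH10 hΩ).2] at this

theorem MemHdiv.hasWeakDiv {v : L2V Ω} (hv : MemHdiv v) : HasWeakDiv v (weakDiv v) := by
  rw [weakDiv, dif_pos hv]
  exact hv.choose_spec

/-- Membership has to be kept beside the equation, because `weakDiv` takes the default value `0` off
`H(div; Ω)`. -/
theorem memHdiv_and_weakDiv_eq_iff (hΩ : IsOpen Ω) {v : L2V Ω} {h : L2 Ω} :
    (MemHdiv v ∧ weakDiv v = h) ↔ HasWeakDiv v h :=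
  ⟨fun ⟨hv, e⟩ => e ▸ hv.hasWeakDiv, fun hv => ⟨⟨h, hv⟩, hv.weakDiv_eq hΩ⟩⟩

/-- Green's formula against `H(div; Ω)`, with the divergence written as a function. -/
theorem memH10_iff_weakDiv (hΩ : IsOpen Ω) {u : L2 Ω} {g : L2V Ω} :
    MemH10 u ∧ weakGrad u = g ↔
      ∀ v : L2V Ω, MemHdiv v → inner ℝ u (weakDiv v) + inner ℝ g v = 0 := by
  rw [memH10_iff_green hΩ]
  refine ⟨fun H v hv => H v _ hv.hasWeakDiv, fun H v h hv => ?_⟩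
  have := H v ⟨h, hv⟩
  rwa [hv.weakDiv_eq hΩ] at this

/-! ### Composition with the coefficient functions -/

/-- The values of `s` lie in the compact interval `[0, 1]`, where `f` is bounded, and `Ω` has finite
measure. -/
theorem Coeffs.Admissible.exists_comp {c : Coeffs d} (hc : c.Admissible)
    (hb : Bornology.IsBounded Ω) (Θ : L2 Ω) {F : Type*} [NormedAddCommGroup F]
    {f : ℝ → F} (hf : Continuous f) :
    ∃ A : Lp F 2 ((volume : Measure (E d)).restrict Ω),
      ∀ᵐ x ∂(volume.restrict Ω), A x = f (c.s (Θ x)) := by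
  obtain ⟨K, hs⟩ := hc.s_lip
  obtain ⟨C, hC⟩ := (isCompact_Icc (a := (0 : ℝ)) (b := 1)).exists_bound_of_continuousOn
    hf.continuousOn
  have : IsFiniteMeasure ((volume : Measure (E d)).restrict Ω) :=
    ⟨by simpa using hb.measure_lt_top⟩
  have h : MemLp (fun x => f (c.s (Θ x))) 2 ((volume : Measure (E d)).restrict Ω) :=
    MemLp.of_bound ((hf.comp hs.continuous).comp_aestronglyMeasurable
      (Lp.aestronglyMeasurable Θ)) C (Filter.Eventually.of_forall fun x => hC _ (hc.s_mem _))
  exact ⟨h.toLp, h.coeFn_toLp⟩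

/-- The factor `b ∘ s ∘ Θ` is bounded, again by compactness of `[0, 1]`. -/
theorem Coeffs.Admissible.exists_smul {c : Coeffs d} (hc : c.Admissible) (Θ : L2 Ω) (v : L2V Ω)
    {b : ℝ → ℝ} (hf : Continuous b) :
    ∃ A : L2V Ω, ∀ᵐ x ∂(volume.restrict Ω), A x = b (c.s (Θ x)) • v x := by
  obtain ⟨K, hs⟩ := hc.s_lip
  obtain ⟨C, hC⟩ := (isCompact_Icc (a := (0 : ℝ)) (b := 1)).exists_bound_of_continuousOn
    hf.continuousOn
  have hm : AEStronglyMeasurable (fun x => b (c.s (Θ x))) ((volume : Measure (E d)).restrict Ω) :=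
    (hf.comp hs.continuous).comp_aestronglyMeasurable (Lp.aestronglyMeasurable Θ)
  have h : MemLp (fun x => b (c.s (Θ x)) • v x) 2 ((volume : Measure (E d)).restrict Ω) := by
    refine (Lp.memLp v).of_le_mul (c := C) (hm.smul (Lp.aestronglyMeasurable v))
      (Filter.Eventually.of_forall fun x => ?_)
    rw [norm_smul]
    exact mul_le_mul_of_nonneg_right (hC _ (hc.s_mem _)) (norm_nonneg _)
  exact ⟨h.toLp, h.coeFn_toLp⟩

/-! ### Equivalence of the two problems -/

/-- The flux formulas that recover `(q, u)` from a conformal solution `(Θ, p)`. -/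
structure IsFluxPair (c : Coeffs d) (Θ p : L2 Ω) (q u : L2V Ω) : Prop where
  q_eq : ∀ᵐ x ∂(volume.restrict Ω), q x =
    -weakGrad Θ x
      - (c.fw (c.s (Θ x)) / c.a (c.s (Θ x))) • (weakGrad p x + c.f₃ (c.s (Θ x)))
      + c.f₁ (c.s (Θ x))
  u_eq : ∀ᵐ x ∂(volume.restrict Ω), u x =
    -((1 / c.a (c.s (Θ x))) • (weakGrad p x + c.f₃ (c.s (Θ x))))

theorem Coeffs.Admissible.a_ne_zero {c : Coeffs d} (hc : c.Admissible) (y : ℝ) : c.a y ≠ 0 := by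
  obtain ⟨m, M, hm, h⟩ := hc.a_bounds
  exact (hm.trans_le (h y).1).ne'

theorem IsFluxPair.unique {c : Coeffs d} {Θ p : L2 Ω} {q u q' u' : L2V Ω}
    (h : IsFluxPair c Θ p q u) (h' : IsFluxPair c Θ p q' u') : q = q' ∧ u = u' := by
  constructor <;> refine Lp.ext ?_
  · filter_upwards [h.q_eq, h'.q_eq] with x hx hx'
    rw [hx, hx']
  · filter_upwards [h.u_eq, h'.u_eq] with x hx hx'
    rw [hx, hx']

theorem Coeffs.Admissible.exists_isFluxPair {c : Coeffs d} (hc : c.Admissible)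
    (hb : Bornology.IsBounded Ω) (Θ p : L2 Ω) : ∃ q u : L2V Ω, IsFluxPair c Θ p q u := by
  obtain ⟨K₁, h₁⟩ := hc.f₁_lip
  obtain ⟨K₃, h₃⟩ := hc.f₃_lip
  obtain ⟨Ka, ha⟩ := hc.a_lip
  obtain ⟨Kw, hw⟩ := hc.fw_lip
  obtain ⟨F₁, hF₁⟩ := hc.exists_comp hb Θ h₁.continuous
  obtain ⟨F₃, hF₃⟩ := hc.exists_comp hb Θ h₃.continuous
  obtain ⟨A, hA⟩ := hc.exists_smul Θ (weakGrad p + F₃)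
    (hw.continuous.div ha.continuous hc.a_ne_zero)
  obtain ⟨B, hB⟩ := hc.exists_smul Θ (weakGrad p + F₃)
    (continuous_const.div ha.continuous hc.a_ne_zero : Continuous fun y => 1 / c.a y)
  refine ⟨-weakGrad Θ - A + F₁, -B, ?_, ?_⟩
  · filter_upwards [hF₁, hF₃, hA, Lp.coeFn_add (weakGrad p) F₃, Lp.coeFn_neg (weakGrad Θ),
      Lp.coeFn_sub (-weakGrad Θ) A, Lp.coeFn_add (-weakGrad Θ - A) F₁]
      with x h1 h3 h4 h5 h6 h7 h8
    simp only [h8, h7, h6, h4, h5, h3, h1, Pi.add_apply, Pi.sub_apply, Pi.neg_apply,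
      Pi.div_apply]
  · filter_upwards [hF₃, hB, Lp.coeFn_add (weakGrad p) F₃, Lp.coeFn_neg B] with x h1 h2 h3 h4
    simp only [h4, h2, h3, h1, Pi.add_apply, Pi.neg_apply, Pi.div_apply]

/-- The two flux equations of the mixed problem say exactly that `Θ, p ∈ H¹₀(Ω)` and that
`(q, u)` are the associated fluxes. -/
theorem flux_equations_iff (hΩ : IsOpen Ω) (hb : Bornology.IsBounded Ω) {c : Coeffs d}
    (hc : c.Admissible) {Θ p : L2 Ω} {q u : L2V Ω} :
    ((∀ v : L2V Ω, MemHdiv v →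
      (∫ x in Ω, inner ℝ (q x) (v x)) - (∫ x in Ω, Θ x * weakDiv v x)
        - (∫ x in Ω, inner ℝ (c.fw (c.s (Θ x)) • u x) (v x))
        = ∫ x in Ω, inner ℝ (c.f₁ (c.s (Θ x))) (v x)) ∧
     (∀ v : L2V Ω, MemHdiv v →
      (∫ x in Ω, inner ℝ (c.a (c.s (Θ x)) • u x) (v x)) - (∫ x in Ω, p x * weakDiv v x)
        + (∫ x in Ω, inner ℝ (c.f₃ (c.s (Θ x))) (v x)) = 0)) ↔
      MemH10 Θ ∧ MemH10 p ∧ IsFluxPair c Θ p q u := by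
  obtain ⟨K₁, h₁⟩ := hc.f₁_lip
  obtain ⟨K₃, h₃⟩ := hc.f₃_lip
  obtain ⟨Ka, ha⟩ := hc.a_lip
  obtain ⟨Kw, hw⟩ := hc.fw_lip
  obtain ⟨F₁, hF₁⟩ := hc.exists_comp hb Θ h₁.continuous
  obtain ⟨F₃, hF₃⟩ := hc.exists_comp hb Θ h₃.continuous
  obtain ⟨W, hW⟩ := hc.exists_smul Θ u hw.continuous
  obtain ⟨A, hA⟩ := hc.exists_smul Θ u ha.continuous
  -- With `W = f_w(s) u`, the equation rearranges to `⟨Θ, ∇·v⟩ + ⟨F₁ + W - q, v⟩ = 0`, which is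
  -- Green's identity for `Θ`.
  have e1 : (∀ v : L2V Ω, MemHdiv v →
      (∫ x in Ω, inner ℝ (q x) (v x)) - (∫ x in Ω, Θ x * weakDiv v x)
        - (∫ x in Ω, inner ℝ (c.fw (c.s (Θ x)) • u x) (v x))
        = ∫ x in Ω, inner ℝ (c.f₁ (c.s (Θ x))) (v x)) ↔
      MemH10 Θ ∧ weakGrad Θ = F₁ + W - q := by
    rw [memH10_iff_weakDiv hΩ]
    refine forall₂_congr fun v _ => ?_
    rw [integral_inner_eq hF₁, integral_inner_eq hW, integral_inner_eq (A := q) ae_refl,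
      integral_mul_eq (A := Θ) (v := weakDiv v) ae_refl ae_refl, inner_sub_left, inner_add_left]
    constructor <;> intro H <;> linarith
  have e2 : (∀ v : L2V Ω, MemHdiv v →
      (∫ x in Ω, inner ℝ (c.a (c.s (Θ x)) • u x) (v x)) - (∫ x in Ω, p x * weakDiv v x)
        + (∫ x in Ω, inner ℝ (c.f₃ (c.s (Θ x))) (v x)) = 0) ↔
      MemH10 p ∧ weakGrad p = -(A + F₃) := by
    rw [memH10_iff_weakDiv hΩ]
    refine forall₂_congr fun v _ => ?_
    rw [integral_inner_eq hF₃, integral_inner_eq hA,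
      integral_mul_eq (A := p) (v := weakDiv v) ae_refl ae_refl, inner_neg_left, inner_add_left]
    constructor <;> intro H <;> linarith
  rw [e1, e2]
  have hR1 : ∀ᵐ x ∂(volume.restrict Ω), (F₁ + W - q) x
      = c.f₁ (c.s (Θ x)) + c.fw (c.s (Θ x)) • u x - q x := by
    filter_upwards [hF₁, hW, Lp.coeFn_sub (F₁ + W) q, Lp.coeFn_add F₁ W] with x h1 h2 h3 h4
    simp only [h3, h4, h1, h2, Pi.add_apply, Pi.sub_apply]
  have hR2 : ∀ᵐ x ∂(volume.restrict Ω), (-(A + F₃)) x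
      = -(c.a (c.s (Θ x)) • u x + c.f₃ (c.s (Θ x))) := by
    filter_upwards [hF₃, hA, Lp.coeFn_neg (A + F₃), Lp.coeFn_add A F₃] with x h1 h2 h3 h4
    simp only [h3, h4, h1, h2, Pi.neg_apply, Pi.add_apply]
  constructor
  · rintro ⟨⟨hΘ, gΘ⟩, hp, gp⟩
    have hu : ∀ᵐ x ∂(volume.restrict Ω), u x =
        -((1 / c.a (c.s (Θ x))) • (weakGrad p x + c.f₃ (c.s (Θ x)))) := by
      filter_upwards [hR2] with x hx
      rw [gp, hx, neg_add_rev, add_right_comm, neg_add_cancel, zero_add, smul_neg, neg_neg,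
        smul_smul, one_div, inv_mul_cancel₀ (hc.a_ne_zero _), one_smul]
    refine ⟨hΘ, hp, ?_, hu⟩
    filter_upwards [hR1, hu] with x hx hx'
    have : (c.fw (c.s (Θ x)) / c.a (c.s (Θ x))) • (weakGrad p x + c.f₃ (c.s (Θ x)))
        = -(c.fw (c.s (Θ x)) • u x) := by
      rw [hx', smul_neg, neg_neg, smul_smul, mul_one_div]
    rw [this, gΘ, hx]
    abel
  · rintro ⟨hΘ, hp, hf⟩
    refine ⟨⟨hΘ, Lp.ext ?_⟩, hp, Lp.ext ?_⟩
    · filter_upwards [hR1, hf.q_eq, hf.u_eq] with x hx hq hu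
      rw [hx, hq, hu, smul_neg, smul_smul, mul_one_div]
      abel
    · filter_upwards [hR2, hf.u_eq] with x hx hu
      rw [hx, hu, smul_neg, smul_smul, mul_one_div, div_self (hc.a_ne_zero _), one_smul]
      abel

/-- The two conservation equations of the mixed problem are the conformal equations for the
associated fluxes. -/
theorem balance_equations_iff (hΩ : IsOpen Ω) (hb : Bornology.IsBounded Ω) {c : Coeffs d}
    (hc : c.Admissible) {τ : ℝ} (hτ : 0 < τ) {Θ' Θ p : L2 Ω} {q u : L2V Ω}
    (hf : IsFluxPair c Θ p q u) (hΘ : MemH10 Θ) (hp : MemH10 p) :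
    (MemHdiv q ∧ MemHdiv u ∧
      (∀ w : L2 Ω, (∫ x in Ω, (c.s (Θ x) - c.s (Θ' x)) * w x)
        + τ * ∫ x in Ω, weakDiv q x * w x = 0) ∧
      ∀ w : L2 Ω, ∫ x in Ω, weakDiv u x * w x = ∫ x in Ω, c.f₂ (c.s (Θ x)) * w x) ↔
      SolvesConformal c τ Θ' Θ p := by
  obtain ⟨K₁, h₁⟩ := hc.f₁_lip
  obtain ⟨K₂, h₂⟩ := hc.f₂_lip
  obtain ⟨K₃, h₃⟩ := hc.f₃_lip
  obtain ⟨Ka, ha⟩ := hc.a_lip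
  obtain ⟨Kw, hw⟩ := hc.fw_lip
  have hwa := hw.continuous.div ha.continuous hc.a_ne_zero
  obtain ⟨F₁, hF₁⟩ := hc.exists_comp hb Θ h₁.continuous
  obtain ⟨F₂, hF₂⟩ := hc.exists_comp hb Θ h₂.continuous
  obtain ⟨F₃, hF₃⟩ := hc.exists_comp hb Θ h₃.continuous
  obtain ⟨S, hS⟩ := hc.exists_comp hb Θ continuous_id
  obtain ⟨S', hS'⟩ := hc.exists_comp hb Θ' continuous_id
  obtain ⟨P, hP⟩ := hc.exists_smul Θ (weakGrad p) hwa
  obtain ⟨Q, hQ⟩ := hc.exists_smul Θ F₃ hwa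
  have hD : ∀ᵐ x ∂(volume.restrict Ω), (S - S') x = c.s (Θ x) - c.s (Θ' x) := by
    filter_upwards [hS, hS', Lp.coeFn_sub S S'] with x h1 h2 h3
    simp only [h1, h2, h3, Pi.sub_apply, id]
  have hG1 : ∀ᵐ x ∂(volume.restrict Ω), (weakGrad Θ + P) x
      = weakGrad Θ x + (c.fw (c.s (Θ x)) / c.a (c.s (Θ x))) • weakGrad p x := by
    filter_upwards [hP, Lp.coeFn_add (weakGrad Θ) P] with x h1 h2
    simp only [h1, h2, Pi.add_apply, Pi.div_apply]
  have hG2 : ∀ᵐ x ∂(volume.restrict Ω), (Q - F₁) x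
      = (c.fw (c.s (Θ x)) / c.a (c.s (Θ x))) • c.f₃ (c.s (Θ x)) - c.f₁ (c.s (Θ x)) := by
    filter_upwards [hQ, hF₁, hF₃, Lp.coeFn_sub Q F₁] with x h1 h2 h3 h4
    simp only [h1, h2, h3, h4, Pi.sub_apply, Pi.div_apply]
  have hU : ∀ᵐ x ∂(volume.restrict Ω), (-u) x
      = (1 / c.a (c.s (Θ x))) • (weakGrad p x + c.f₃ (c.s (Θ x))) := by
    filter_upwards [hf.u_eq, Lp.coeFn_neg u] with x h1 h2
    simp only [h2, h1, Pi.neg_apply, neg_neg]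
  -- The two fields tested against `∇v` in the saturation equation add up to `-q`.
  have hq : (weakGrad Θ + P) + (Q - F₁) = -q := by
    refine Lp.ext ?_
    filter_upwards [hG1, hG2, hf.q_eq, Lp.coeFn_add (weakGrad Θ + P) (Q - F₁), Lp.coeFn_neg q]
      with x h1 h2 h3 h4 h5
    rw [h4, h5, Pi.add_apply, Pi.neg_apply, h1, h2, h3, smul_add]
    abel
  -- Testing against all of `L²` makes the balance an equation in `L²`: `∇·q = -(S - S')/τ`.
  have hbal : (MemHdiv q ∧ ∀ w : L2 Ω, (∫ x in Ω, (c.s (Θ x) - c.s (Θ' x)) * w x)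
        + τ * ∫ x in Ω, weakDiv q x * w x = 0) ↔ HasWeakDiv q (-(τ⁻¹ • (S - S'))) := by
    rw [← memHdiv_and_weakDiv_eq_iff hΩ]
    refine and_congr_right fun _ => ?_
    have : ∀ w : L2 Ω, (∫ x in Ω, (c.s (Θ x) - c.s (Θ' x)) * w x)
        + τ * ∫ x in Ω, weakDiv q x * w x = inner ℝ (S - S' + τ • weakDiv q) w := fun w => by
      rw [integral_mul_eq hD (v := w) ae_refl,
        integral_mul_eq (A := weakDiv q) (v := w) ae_refl ae_refl, inner_add_left,
        real_inner_smul_left]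
    simp only [this]
    constructor
    · intro H
      -- The test function is the residual `S - S' + τ ∇·q` itself.
      have h0 := inner_self_eq_zero.1 (H _)
      rw [← smul_neg, eq_inv_smul_iff₀ hτ.ne', eq_neg_iff_add_eq_zero, add_comm, h0]
    · intro H w
      rw [H, smul_neg, smul_inv_smul₀ hτ.ne', add_neg_cancel, inner_zero_left]
  have htot : (MemHdiv u ∧ ∀ w : L2 Ω,
      ∫ x in Ω, weakDiv u x * w x = ∫ x in Ω, c.f₂ (c.s (Θ x)) * w x) ↔ HasWeakDiv u F₂ := by
    rw [← memHdiv_and_weakDiv_eq_iff hΩ]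
    refine and_congr_right fun _ => ?_
    have : ∀ w : L2 Ω, (∫ x in Ω, weakDiv u x * w x = ∫ x in Ω, c.f₂ (c.s (Θ x)) * w x) ↔
        inner ℝ (weakDiv u) w = inner ℝ F₂ w := fun w => by
      rw [integral_mul_eq hF₂ (v := w) ae_refl,
        integral_mul_eq (A := weakDiv u) (v := w) ae_refl ae_refl]
    simp only [this]
    exact ⟨ext_inner_right ℝ, fun h w => by rw [h]⟩
  -- The saturation equation is `-τ` times Green's identity for `q` with this divergence.
  have hsat : HasWeakDiv q (-(τ⁻¹ • (S - S'))) ↔ ∀ v : L2 Ω, MemH10 v →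
      (∫ x in Ω, (c.s (Θ x) - c.s (Θ' x)) * v x)
      + τ * ((∫ x in Ω, inner ℝ
            (weakGrad Θ x + (c.fw (c.s (Θ x)) / c.a (c.s (Θ x))) • weakGrad p x) (weakGrad v x))
          + ∫ x in Ω, inner ℝ
            ((c.fw (c.s (Θ x)) / c.a (c.s (Θ x))) • c.f₃ (c.s (Θ x)) - c.f₁ (c.s (Θ x)))
            (weakGrad v x)) = 0 := by
    rw [hasWeakDiv_iff_green hΩ]
    refine forall₂_congr fun v _ => ?_
    rw [integral_mul_eq hD (v := v) ae_refl, integral_inner_eq hG1, integral_inner_eq hG2,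
      ← inner_add_left, hq, inner_neg_left, inner_neg_right, real_inner_smul_right,
      real_inner_comm (S - S'), real_inner_comm q]
    constructor
    · intro H
      field_simp at H
      linarith
    · intro H
      field_simp
      linarith
  have hpres : HasWeakDiv u F₂ ↔ ∀ w : L2 Ω, MemH10 w →
      ∫ x in Ω, inner ℝ ((1 / c.a (c.s (Θ x))) • (weakGrad p x + c.f₃ (c.s (Θ x)))) (weakGrad w x)
        = ∫ x in Ω, c.f₂ (c.s (Θ x)) * w x := by
    rw [hasWeakDiv_iff_green hΩ]
    refine forall₂_congr fun w _ => ?_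
    rw [integral_mul_eq hF₂ (v := w) ae_refl, integral_inner_eq hU, inner_neg_left,
      real_inner_comm F₂, real_inner_comm u]
    constructor <;> intro H <;> linarith
  constructor
  · rintro ⟨m1, m2, b1, b2⟩
    exact ⟨hΘ, hp, hsat.1 (hbal.1 ⟨m1, b1⟩), hpres.1 (htot.1 ⟨m2, b2⟩)⟩
  · rintro ⟨-, -, b1, b2⟩
    obtain ⟨m1, c1⟩ := hbal.2 (hsat.2 b1)
    obtain ⟨m2, c2⟩ := htot.2 (hpres.2 b2)
    exact ⟨m1, m2, c1, c2⟩

/-- Mixed solutions are the conformal solutions together with their fluxes. -/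
theorem solvesMixed_iff (hΩ : IsOpen Ω) (hb : Bornology.IsBounded Ω) {c : Coeffs d}
    (hc : c.Admissible) {τ : ℝ} (hτ : 0 < τ) {Θ' Θ p : L2 Ω} {q u : L2V Ω} :
    SolvesMixed c τ Θ' Θ p q u ↔ SolvesConformal c τ Θ' Θ p ∧ IsFluxPair c Θ p q u := by
  constructor
  · intro h
    obtain ⟨hΘ, hp, hf⟩ := (flux_equations_iff hΩ hb hc).1 ⟨h.flux, h.total_flux⟩
    exact ⟨(balance_equations_iff hΩ hb hc hτ hf hΘ hp).1
      ⟨h.q_mem, h.u_mem, h.balance, h.total_balance⟩, hf⟩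
  · rintro ⟨h, hf⟩
    obtain ⟨hq, hu, b1, b2⟩ := (balance_equations_iff hΩ hb hc hτ hf h.Θ_mem h.p_mem).2 h
    obtain ⟨f1, f2⟩ := (flux_equations_iff hΩ hb hc).2 ⟨h.Θ_mem, h.p_mem, hf⟩
    exact ⟨hq, hu, b1, f1, b2, f2⟩

end TwoPhase

end

/-! ### Transfer of solutions, existence and uniqueness -/

theorem mainTheorem4 (d : ℕ) (Ω : Set (E d)) (hΩ : IsOpen Ω) (hb : Bornology.IsBounded Ω)
    (c : Coeffs d) (hc : c.Admissible) (τ : ℝ) (hτ : 0 < τ) (Θ' : L2 Ω) :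
    -- conformal solutions give mixed solutions, with explicit fluxes
    (∀ Θ p : L2 Ω, SolvesConformal c τ Θ' Θ p →
      ∃ q u : L2V Ω,
        (∀ᵐ x ∂(volume.restrict Ω), q x =
          -weakGrad Θ x
            - (c.fw (c.s (Θ x)) / c.a (c.s (Θ x))) • (weakGrad p x + c.f₃ (c.s (Θ x)))
            + c.f₁ (c.s (Θ x))) ∧
        (∀ᵐ x ∂(volume.restrict Ω), u x =
          -((1 / c.a (c.s (Θ x))) • (weakGrad p x + c.f₃ (c.s (Θ x))))) ∧
        SolvesMixed c τ Θ' Θ p q u) ∧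
    -- mixed solutions lie in `H¹₀` and are conformal solutions
    (∀ (Θ p : L2 Ω) (q u : L2V Ω), SolvesMixed c τ Θ' Θ p q u →
      MemH10 Θ ∧ MemH10 p ∧ SolvesConformal c τ Θ' Θ p) ∧
    -- hence existence and uniqueness carry over
    ((∃ Θ p : L2 Ω, SolvesConformal c τ Θ' Θ p) ↔
      ∃ (Θ p : L2 Ω) (q u : L2V Ω), SolvesMixed c τ Θ' Θ p q u) ∧
    ({z : L2 Ω × L2 Ω | SolvesConformal c τ Θ' z.1 z.2}.Subsingleton ↔
      {z : L2 Ω × L2 Ω × L2V Ω × L2V Ω |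
        SolvesMixed c τ Θ' z.1 z.2.1 z.2.2.1 z.2.2.2}.Subsingleton) := by
  have key : ∀ {Θ p : L2 Ω} {q u : L2V Ω}, SolvesMixed c τ Θ' Θ p q u ↔
      SolvesConformal c τ Θ' Θ p ∧ IsFluxPair c Θ p q u := solvesMixed_iff hΩ hb hc hτ
  refine ⟨fun Θ p h => ?_, fun Θ p q u h => ?_, ⟨?_, ?_⟩, ⟨?_, ?_⟩⟩
  · obtain ⟨q, u, hf⟩ := hc.exists_isFluxPair hb Θ p
    exact ⟨q, u, hf.q_eq, hf.u_eq, key.2 ⟨h, hf⟩⟩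
  · have hC := (key.1 h).1
    exact ⟨hC.Θ_mem, hC.p_mem, hC⟩
  · rintro ⟨Θ, p, h⟩
    obtain ⟨q, u, hf⟩ := hc.exists_isFluxPair hb Θ p
    exact ⟨Θ, p, q, u, key.2 ⟨h, hf⟩⟩
  · rintro ⟨Θ, p, q, u, h⟩
    exact ⟨Θ, p, (key.1 h).1⟩
  · rintro H ⟨Θ₁, p₁, q₁, u₁⟩ h₁ ⟨Θ₂, p₂, q₂, u₂⟩ h₂
    obtain ⟨k₁, f₁⟩ := key.1 h₁
    obtain ⟨k₂, f₂⟩ := key.1 h₂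
    obtain ⟨rfl, rfl⟩ := Prod.mk.inj
      (H (show (Θ₁, p₁) ∈ _ from k₁) (show (Θ₂, p₂) ∈ _ from k₂))
    -- Once `(Θ, p)` is unique, so are the fluxes, since the formulas determine them.
    obtain ⟨rfl, rfl⟩ := f₁.unique f₂
    rfl
  · rintro H ⟨Θ₁, p₁⟩ h₁ ⟨Θ₂, p₂⟩ h₂
    -- Conversely, every conformal solution extends to a mixed one, so two distinct conformal
    -- solutions would give two distinct mixed solutions.
    obtain ⟨q₁, u₁, f₁⟩ := hc.exists_isFluxPair hb Θ₁ p₁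
    obtain ⟨q₂, u₂, f₂⟩ := hc.exists_isFluxPair hb Θ₂ p₂
    have := H (show (Θ₁, p₁, q₁, u₁) ∈ _ from key.2 ⟨h₁, f₁⟩)
      (show (Θ₂, p₂, q₂, u₂) ∈ _ from key.2 ⟨h₂, f₂⟩)
    simp only [Prod.mk.injEq] at this ⊢
    exact ⟨this.1, this.2.1⟩
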